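/- Theorem ($L^p$-membership). For real $0<a<1$, $0<c<1$ let $\zeta(s,a,c)$ be the Lerch zeta function, i.e. the entire function of $s$ with $\zeta(s,a,c)=\sum_{n\ge 0}e^{2\pi i n a}(n+c)^{-s}$ for $\operatorname{Re}(s)>1$, and put $$L^{\pm}(s,a,c)=\zeta(s,a,c)\pm e^{-2\pi i a}\,\zeta(s,1-a,1-c).$$ For $s\in\mathbb C$ let $\mathcal E_s$ be the complex vector space of functions of $(a,c)\in(0,1)^2$ spanned by the four functions $$L^{+}(s,a,c),\quad L^{-}(s,a,c),\quad e^{-2\pi i ac}L^{+}(1-s,1-c,a),\quad e^{-2\pi i ac}L^{-}(1-s,1-c,a).$$ Then $\mathcal E_s$ is two-dimensional for every $s\in\mathbb C$. Moreover, with $\Box=[0,1]^2$ (whose boundary is a null set): (1) Suppose $1\le p<2$. Then for every $s\in\mathbb C$ all functions in $\mathcal E_s$ belong to $L^p(\Box,da\,dc)$ if and only if $$1-\frac1p<\operatorname{Re}(s)<\frac1p;$$ otherwise, no nonzero function in $\mathcal E_s$ belongs to $L^p(\Box,da\,dc)$. (2) Suppose $2\le p\le\infty$. Then for every $s\in\mathbb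 C$ no nonzero function in $\mathcal E_s$ belongs to $L^p(\Box,da\,dc)$. -/

import Mathlib

open Set MeasureTheory
open scoped ENNReal

noncomputable section

/-- `IsLerchContinuation a c f` says that `f` is an entire function of `s` which is given by the
Lerch series `∑_{n ≥ 0} e^{2π i n a} (n + c)^{-s}` on the half plane `Re s > 1`. By the identity
theorem there is at most one such `f`. -/
def IsLerchContinuation (a c : ℝ) (f : ℂ → ℂ) : Prop :=
  Differentiable ℂ f ∧
    ∀ s : ℂ, 1 < s.re →
      HasSum (fun n : ℕ =>
        Complex.exp (2 * Real.pi * Complex.I * n * a) * ((n : ℂ) + (c : ℂ)) ^ (-s)) (f s)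

open Classical in
/-- The Lerch zeta function `ζ(s, a, c)`, analytically continued to all `s ∈ ℂ`.
It is only used for `0 < a < 1` and `0 < c < 1`, where the continuation is entire. -/
def lerchZeta (s : ℂ) (a c : ℝ) : ℂ :=
  if h : ∃ f : ℂ → ℂ, IsLerchContinuation a c f then h.choose s else 0

/-- `L⁺(s, a, c) = ζ(s, a, c) + e^{-2π i a} ζ(s, 1 - a, 1 - c)`. -/
def lerchLPlus (s : ℂ) (a c : ℝ) : ℂ :=
  lerchZeta s a c + Complex.exp (-2 * Real.pi * Complex.I * a) * lerchZeta s (1 - a) (1 - c)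

/-- `L⁻(s, a, c) = ζ(s, a, c) - e^{-2π i a} ζ(s, 1 - a, 1 - c)`. -/
def lerchLMinus (s : ℂ) (a c : ℝ) : ℂ :=
  lerchZeta s a c - Complex.exp (-2 * Real.pi * Complex.I * a) * lerchZeta s (1 - a) (1 - c)

/-- The closed unit square in the `(a, c)`-plane. -/
def lerchSquare : Set (ℝ × ℝ) := Icc 0 1 ×ˢ Icc 0 1

/-- A function of `(a, c)` on the open unit square, as a function on the plane that vanishes
off the open square (the boundary of the square is a null set). -/
def onOpenSquare (g : ℝ → ℝ → ℂ) : ℝ × ℝ → ℂ :=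
  (Ioo (0 : ℝ) 1 ×ˢ Ioo (0 : ℝ) 1).indicator fun x => g x.1 x.2

/-- The complex vector space `𝓔_s` of functions on the open unit square spanned by the four
functions `L^±(s, a, c)` and `e^{-2π i a c} L^±(1 - s, 1 - c, a)`. -/
def lerchSpace (s : ℂ) : Submodule ℂ (ℝ × ℝ → ℂ) :=
  Submodule.span ℂ
    {onOpenSquare fun a c => lerchLPlus s a c,
     onOpenSquare fun a c => lerchLMinus s a c,
     onOpenSquare fun a c =>
      Complex.exp (-2 * Real.pi * Complex.I * a * c) * lerchLPlus (1 - s) (1 - c) a,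
     onOpenSquare fun a c =>
      Complex.exp (-2 * Real.pi * Complex.I * a * c) * lerchLMinus (1 - s) (1 - c) a}

end

/-!
The functions `L⁺` and `L⁻` are the even (`k = 0`) and odd (`k = 1`) cases of
`∑_{n ∈ ℤ} sgn(n + c)^k e^{2π i n a} |n + c|^{-s}`, and `ζ(s, a, c)` is half their sum. Multiplied by
the Gamma factor `Γ_ℝ(s + k)` such a series is the Mellin transform at `(s + k) / 2` of the theta
function `∑_n (n + c)^k e^{2π i n a} e^{-π (n + c)² t}`. Since `a` and `c` are not integers, the theta
function decays rapidly at `∞` and, by its functional equation (a form of that of the Jacobi theta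
function), also at `0`. This gives the continuation to all `s` (`lerchZeta_eq`) and a functional
equation relating `(s, a, c)` and `(1 - s, 1 - c, a)` (`lerchCompleted_functional_equation`).

The operator `(R F)(a, c) = e^{-2π i a c} F(1 - c, a)` (`lerchTurn`) preserves `L^p` and satisfies
`R⁴ = 1`. For `Re s > 0` the factors `Γ_ℝ(s)` and `Γ_ℝ(s + 1)` have neither zeros nor poles, so by
the functional equation `𝓔_s` is spanned by `L^±(s, ·, ·)` alone (`lerchSpace_of_re_pos`); for
`Re s < 1` it is the image under `R` of the analogous span at `1 - s` (`lerchSpace_of_re_lt_one`).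
No point escapes both descriptions, so everything reduces to `Re s > 0`.

There, removing the two terms `n = 0, -1` from the theta series before taking the Mellin transform
shows that `L^±` equals `c^{-s} ± e^{-2π i a} (1 - c)^{-s}` up to
`O(1 + a^{τ - 1} + (1 - a)^{τ - 1})` for any `τ ≤ Re s` with `τ < 1`
(`exists_norm_lerchParity_sub_le`). Taking `τ = Re s` gives membership in `L^p` for
`1 - 1/p < Re s < 1/p`. Conversely, `α L⁺ + β L⁻` has the singularities `(α + β) c^{-s}` at `c = 0`
and, up to a unimodular factor, `(α - β) (1 - c)^{-s}` at `c = 1`. They do not both vanish unless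
`α = β = 0`, and neither is in `L^p` when `p Re s ≥ 1` (`not_memLp_of_mem_lerchPairSpan`). For
`p = 2` and `Re s ≥ 1/2` this also gives linear independence, hence the dimension. If
`1 ≤ p ≤ 2` and `s` is outside the strip, then `p Re s ≥ 1` or `p Re (1 - s) ≥ 1`; the case `p > 2`
follows from `p = 2`, since the square has finite measure.
-/

/-! ### Twisted theta functions -/

/-- The theta function `θ_k(t; a, c) = ∑_{n ∈ ℤ} (n + c)^k e^{2π i n a} e^{-π (n + c)² t}`. Only
`k = 0` (even) and `k = 1` (odd) are used, and only for `t > 0`. -/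
noncomputable def lerchTheta (k : ℕ) (a c t : ℝ) : ℂ :=
  ∑' n : ℤ, Complex.exp (2 * Real.pi * Complex.I * n * a) *
    (((n + c : ℝ) : ℂ) ^ k * (Real.exp (-Real.pi * (n + c) ^ 2 * t) : ℝ))

lemma lerchTheta_term_zero (a c t : ℝ) (n : ℤ) :
    Complex.exp (2 * Real.pi * Complex.I * n * a) *
      (((n + c : ℝ) : ℂ) ^ 0 * (Real.exp (-Real.pi * (n + c) ^ 2 * t) : ℝ)) =
    Complex.exp (-Real.pi * c ^ 2 * t) *
      jacobiTheta₂_term n (a + Complex.I * c * t) (Complex.I * t) := by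
  rw [jacobiTheta₂_term, pow_zero, one_mul, Complex.ofReal_exp, ← Complex.exp_add,
    ← Complex.exp_add]
  congr 1
  push_cast
  linear_combination (-2 * Real.pi * n * c * t - Real.pi * n ^ 2 * t) * Complex.I_sq

lemma lerchTheta_term_one (a c t : ℝ) (n : ℤ) :
    Complex.exp (2 * Real.pi * Complex.I * n * a) *
      (((n + c : ℝ) : ℂ) ^ 1 * (Real.exp (-Real.pi * (n + c) ^ 2 * t) : ℝ)) =
    Complex.exp (-Real.pi * c ^ 2 * t) *
      (jacobiTheta₂'_term n (a + Complex.I * c * t) (Complex.I * t) / (2 * Real.pi * Complex.I) +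
        c * jacobiTheta₂_term n (a + Complex.I * c * t) (Complex.I * t)) := by
  have h := lerchTheta_term_zero a c t n
  have hpi : (Real.pi : ℂ) ≠ 0 := by exact_mod_cast Real.pi_ne_zero
  rw [jacobiTheta₂'_term]
  have e : 2 * Real.pi * Complex.I * n * jacobiTheta₂_term n (a + Complex.I * c * t)
      (Complex.I * t) / (2 * Real.pi * Complex.I) =
      n * jacobiTheta₂_term n (a + Complex.I * c * t) (Complex.I * t) := by
    field_simp [Complex.I_ne_zero]
  rw [e]
  rw [pow_zero, one_mul] at h
  push_cast at h ⊢
  linear_combination (n + c : ℂ) * h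

lemma hasSum_lerchTheta_zero (a c : ℝ) {t : ℝ} (ht : 0 < t) :
    HasSum (fun n : ℤ => Complex.exp (2 * Real.pi * Complex.I * n * a) *
      (((n + c : ℝ) : ℂ) ^ 0 * (Real.exp (-Real.pi * (n + c) ^ 2 * t) : ℝ)))
      (Complex.exp (-Real.pi * c ^ 2 * t) *
        jacobiTheta₂ (a + Complex.I * c * t) (Complex.I * t)) := by
  simp_rw [lerchTheta_term_zero]
  exact (hasSum_jacobiTheta₂_term _ (by simpa using ht)).mul_left _

lemma hasSum_lerchTheta_one (a c : ℝ) {t : ℝ} (ht : 0 < t) :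
    HasSum (fun n : ℤ => Complex.exp (2 * Real.pi * Complex.I * n * a) *
      (((n + c : ℝ) : ℂ) ^ 1 * (Real.exp (-Real.pi * (n + c) ^ 2 * t) : ℝ)))
      (Complex.exp (-Real.pi * c ^ 2 * t) *
        (jacobiTheta₂' (a + Complex.I * c * t) (Complex.I * t) / (2 * Real.pi * Complex.I) +
          c * jacobiTheta₂ (a + Complex.I * c * t) (Complex.I * t))) := by
  simp_rw [lerchTheta_term_one]
  have ht' : 0 < (Complex.I * t).im := by simpa using ht
  exact (((hasSum_jacobiTheta₂'_term _ ht').div_const _).add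
    ((hasSum_jacobiTheta₂_term _ ht').mul_left _)).mul_left _

lemma lerchTheta_zero (a c : ℝ) {t : ℝ} (ht : 0 < t) :
    lerchTheta 0 a c t = Complex.exp (-Real.pi * c ^ 2 * t) *
      jacobiTheta₂ (a + Complex.I * c * t) (Complex.I * t) :=
  (hasSum_lerchTheta_zero a c ht).tsum_eq

lemma lerchTheta_one (a c : ℝ) {t : ℝ} (ht : 0 < t) :
    lerchTheta 1 a c t = Complex.exp (-Real.pi * c ^ 2 * t) *
      (jacobiTheta₂' (a + Complex.I * c * t) (Complex.I * t) / (2 * Real.pi * Complex.I) +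
        c * jacobiTheta₂ (a + Complex.I * c * t) (Complex.I * t)) :=
  (hasSum_lerchTheta_one a c ht).tsum_eq

lemma hasSum_lerchTheta {k : ℕ} (hk : k ≤ 1) (a c : ℝ) {t : ℝ} (ht : 0 < t) :
    HasSum (fun n : ℤ => Complex.exp (2 * Real.pi * Complex.I * n * a) *
      (((n + c : ℝ) : ℂ) ^ k * (Real.exp (-Real.pi * (n + c) ^ 2 * t) : ℝ)))
      (lerchTheta k a c t) := by
  interval_cases k
  · exact (hasSum_lerchTheta_zero a c ht).summable.hasSum
  · exact (hasSum_lerchTheta_one a c ht).summable.hasSum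

lemma continuousAt_lerchTheta {k : ℕ} (hk : k ≤ 1) (x : ℝ × ℝ × ℝ) (hx : 0 < x.2.2) :
    ContinuousAt (fun x : ℝ × ℝ × ℝ => lerchTheta k x.1 x.2.1 x.2.2) x := by
  have hpos : ∀ᶠ y : ℝ × ℝ × ℝ in nhds x, 0 < y.2.2 :=
    continuousAt_snd.snd.eventually (lt_mem_nhds hx)
  have hx' : 0 < (Complex.I * (x.2.2 : ℂ)).im := by simpa using hx
  have hg : Continuous fun y : ℝ × ℝ × ℝ =>
      (((y.1 : ℂ) + Complex.I * y.2.1 * y.2.2, Complex.I * (y.2.2 : ℂ)) : ℂ × ℂ) := by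
    fun_prop
  have h0 : ContinuousAt (fun y : ℝ × ℝ × ℝ =>
      jacobiTheta₂ (y.1 + Complex.I * y.2.1 * y.2.2) (Complex.I * y.2.2)) x :=
    ContinuousAt.comp (f := fun y : ℝ × ℝ × ℝ =>
      (((y.1 : ℂ) + Complex.I * y.2.1 * y.2.2, Complex.I * (y.2.2 : ℂ)) : ℂ × ℂ))
      (g := fun p : ℂ × ℂ => jacobiTheta₂ p.1 p.2) (continuousAt_jacobiTheta₂ _ hx')
      hg.continuousAt
  have h1 : ContinuousAt (fun y : ℝ × ℝ × ℝ =>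
      jacobiTheta₂' (y.1 + Complex.I * y.2.1 * y.2.2) (Complex.I * y.2.2)) x :=
    ContinuousAt.comp (f := fun y : ℝ × ℝ × ℝ =>
      (((y.1 : ℂ) + Complex.I * y.2.1 * y.2.2, Complex.I * (y.2.2 : ℂ)) : ℂ × ℂ))
      (g := fun p : ℂ × ℂ => jacobiTheta₂' p.1 p.2) (continuousAt_jacobiTheta₂' _ hx')
      hg.continuousAt
  interval_cases k
  · refine ContinuousAt.congr ?_ (hpos.mono fun y hy => (lerchTheta_zero _ _ hy).symm)
    fun_prop
  · refine ContinuousAt.congr ?_ (hpos.mono fun y hy => (lerchTheta_one _ _ hy).symm)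
    fun_prop

/-- The functional equation of the theta function: Poisson summation exchanges the twist `a` and
the shift `c`. -/
lemma lerchTheta_functional_equation {k : ℕ} (hk : k ≤ 1) (a c : ℝ) {t : ℝ} (ht : 0 < t) :
    lerchTheta k a c (1 / t) = Complex.I ^ k * Complex.exp (-2 * Real.pi * Complex.I * a * c) *
      ((t ^ (k + 1 / 2 : ℝ) : ℝ) : ℂ) * lerchTheta k (1 - c) a t := by
  have ht1 : 0 < 1 / t := by positivity
  have htc : (t : ℂ) ≠ 0 := by exact_mod_cast ht.ne'
  have hpi : (Real.pi : ℂ) ≠ 0 := by exact_mod_cast Real.pi_ne_zero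
  set z : ℂ := a + Complex.I * c * (1 / t : ℝ) with hz
  set τ : ℂ := Complex.I * (1 / t : ℝ) with hτ
  have hτ0 : τ ≠ 0 := by
    rw [hτ]; push_cast; exact mul_ne_zero Complex.I_ne_zero (one_div_ne_zero htc)
  have e1 : -1 / τ = Complex.I * t := by
    rw [hτ]; push_cast; field_simp; simp
  have e2 : z / τ = -(((1 - c : ℝ) : ℂ) + Complex.I * a * t) + 1 := by
    rw [div_eq_iff hτ0, hz, hτ]; push_cast; field_simp
    linear_combination (a : ℂ) * t * Complex.I_sq
  have e3 : 1 / (-Complex.I * τ) ^ (1 / 2 : ℂ) = ((t ^ (1 / 2 : ℝ) : ℝ) : ℂ) := by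
    have : -Complex.I * τ = ((1 / t : ℝ) : ℂ) := by
      rw [hτ]; linear_combination (-((1 / t : ℝ) : ℂ)) * Complex.I_sq
    rw [this, show (1 / 2 : ℂ) = ((1 / 2 : ℝ) : ℂ) by push_cast; rfl,
      ← Complex.ofReal_cpow ht1.le]
    rw [Real.div_rpow zero_le_one ht.le, Real.one_rpow]; push_cast; simp
  have e4 : Complex.exp (-Real.pi * c ^ 2 * (1 / t : ℝ)) *
      Complex.exp (-Real.pi * Complex.I * z ^ 2 / τ) =
      Complex.exp (-2 * Real.pi * Complex.I * a * c) * Complex.exp (-Real.pi * a ^ 2 * t) := by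
    rw [← Complex.exp_add, ← Complex.exp_add]
    congr 1
    rw [hz, hτ]; push_cast; field_simp
    linear_combination (-(c : ℂ) ^ 2) * Complex.I_sq
  have f0 := jacobiTheta₂_functional_equation z τ
  rw [e1, e2, jacobiTheta₂_add_left, jacobiTheta₂_neg_left, e3] at f0
  interval_cases k
  · rw [lerchTheta_zero _ _ ht1, lerchTheta_zero _ _ ht, ← hz, ← hτ, f0]
    simp only [Nat.cast_zero, zero_add, pow_zero, one_mul]
    linear_combination ((t ^ (1 / 2 : ℝ) : ℝ) : ℂ) * jacobiTheta₂ (((1 - c : ℝ) : ℂ) +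
      Complex.I * a * t) (Complex.I * t) * e4
  · have f1 := jacobiTheta₂'_functional_equation z τ
    rw [e1, e2, jacobiTheta₂_add_left, jacobiTheta₂_neg_left, jacobiTheta₂'_add_left,
      jacobiTheta₂'_neg_left, e3] at f1
    rw [lerchTheta_one _ _ ht1, lerchTheta_one _ _ ht, ← hz, ← hτ, f0, f1]
    have e5 : ((t ^ ((1 : ℕ) + 1 / 2 : ℝ) : ℝ) : ℂ) = t * ((t ^ (1 / 2 : ℝ) : ℝ) : ℂ) := by
      rw [Nat.cast_one, Real.rpow_add ht, Real.rpow_one]; push_cast; rfl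
    rw [e5, pow_one]
    generalize jacobiTheta₂ (((1 - c : ℝ) : ℂ) + Complex.I * a * t) (Complex.I * t) = J
    generalize jacobiTheta₂' (((1 - c : ℝ) : ℂ) + Complex.I * a * t) (Complex.I * t) = J'
    generalize ((t ^ (1 / 2 : ℝ) : ℝ) : ℂ) = r
    have e6 : 1 / τ = -Complex.I * t := by
      rw [div_eq_iff hτ0, hτ]; push_cast; field_simp; linear_combination Complex.I_sq
    have e7 : -z / τ + c = Complex.I * t * a := by
      rw [neg_div, e2]; push_cast; ring
    have e8 : r * Complex.exp (-Real.pi * Complex.I * z ^ 2 / τ) / τ *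
        (-J' - 2 * Real.pi * Complex.I * z * J) / (2 * Real.pi * Complex.I) +
        c * (r * Complex.exp (-Real.pi * Complex.I * z ^ 2 / τ) * J) =
        r * Complex.exp (-Real.pi * Complex.I * z ^ 2 / τ) *
          (Complex.I * t * (J' / (2 * Real.pi * Complex.I) + a * J)) := by
      have : Complex.I * t * (J' / (2 * Real.pi * Complex.I) + a * J) =
        -(1 / τ) * (J' / (2 * Real.pi * Complex.I)) + (-z / τ + c) * J := by
        rw [e6, e7]; ring
      rw [this]
      have hI := Complex.I_ne_zero
      field_simp
      ring
    rw [e8]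
    linear_combination r * (Complex.I * t * (J' / (2 * Real.pi * Complex.I) + a * J)) * e4

/-- Reflecting `n ↦ -1 - n` in the defining sum. -/
lemma lerchTheta_one_sub (k : ℕ) (a c t : ℝ) :
    Complex.exp (-2 * Real.pi * Complex.I * a) * lerchTheta k (1 - a) (1 - c) t =
      (-1) ^ k * lerchTheta k a c t := by
  rw [lerchTheta, lerchTheta, ← tsum_mul_left, ← tsum_mul_left,
    ← ((Equiv.neg ℤ).trans (Equiv.subRight (1 : ℤ))).tsum_eq]
  refine tsum_congr fun n => ?_
  simp only [Equiv.trans_apply, Equiv.neg_apply, Equiv.subRight_apply]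
  have e1 : (((-n - 1 : ℤ) : ℝ) + (1 - c)) = -(n + c) := by push_cast; ring
  have e2 : Complex.exp (-2 * Real.pi * Complex.I * a) *
      Complex.exp (2 * Real.pi * Complex.I * (-n - 1 : ℤ) * (1 - a : ℝ)) =
      Complex.exp (2 * Real.pi * Complex.I * n * a) := by
    rw [← Complex.exp_add, Complex.exp_eq_exp_iff_exists_int]
    exact ⟨-n - 1, by push_cast; ring⟩
  rw [e1, neg_sq, ← e2, Complex.ofReal_neg, neg_pow (((n + c : ℝ) : ℂ))]
  ring

/-- The total weight `∑_n e^{-|n|/2}` which bounds, up to the factor `e^{-t}`, the tail of the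
theta series for `t ≥ 1`. -/
noncomputable def lerchTailConst : ℝ := ∑' n : ℤ, Real.exp (-(|(n : ℝ)| / 2))

lemma summable_exp_neg_abs_half : Summable fun n : ℤ => Real.exp (-(|(n : ℝ)| / 2)) := by
  have h : Summable fun n : ℕ => Real.exp (-((n : ℝ) / 2)) := by
    refine (Real.summable_exp_nat_mul_of_ge (c := -(1 / 2)) (by norm_num)
      (f := fun n => (n : ℝ)) fun i => le_rfl).congr fun n => ?_
    ring_nf
  apply Summable.of_nat_of_neg <;> simpa using h

lemma lerchTailConst_nonneg : 0 ≤ lerchTailConst := tsum_nonneg fun _ => (Real.exp_pos _).le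

lemma norm_exp_two_pi_I_mul (a : ℝ) (n : ℤ) :
    ‖Complex.exp (2 * Real.pi * Complex.I * n * a)‖ = 1 := by
  rw [show 2 * Real.pi * Complex.I * n * a = ((2 * Real.pi * n * a : ℝ) : ℂ) * Complex.I by
    push_cast; ring]
  exact Complex.norm_exp_ofReal_mul_I _

lemma norm_exp_neg_two_pi_I_mul (a : ℝ) :
    ‖Complex.exp (-2 * Real.pi * Complex.I * a)‖ = 1 := by
  simpa using norm_exp_two_pi_I_mul a (-1)

lemma pow_mul_exp_le {k : ℕ} (hk : k ≤ 1) {y t : ℝ} (hy : 1 ≤ y) (ht : 1 ≤ t) :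
    y ^ k * Real.exp (-Real.pi * y ^ 2 * t) ≤ Real.exp (-t) * Real.exp (-y) := by
  have h1 : y ^ k ≤ Real.exp (y - 1) :=
    (pow_le_pow_right₀ hy hk).trans (by
      rw [pow_one]; have := Real.add_one_le_exp (y - 1); linarith)
  calc y ^ k * Real.exp (-Real.pi * y ^ 2 * t)
      ≤ Real.exp (y - 1) * Real.exp (-Real.pi * y ^ 2 * t) := by gcongr
    _ = Real.exp (y - 1 + -Real.pi * y ^ 2 * t) := (Real.exp_add _ _).symm
    _ ≤ Real.exp (-t + -y) := by
      apply Real.exp_le_exp.mpr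
      have h2 : t ≤ y ^ 2 * t := le_mul_of_one_le_left (by linarith) (by nlinarith)
      have h3 : y ^ 2 ≤ y ^ 2 * t := le_mul_of_one_le_right (by positivity) ht
      have h4 : 2 * (y ^ 2 * t) ≤ Real.pi * (y ^ 2 * t) := by
        gcongr; exact Real.two_le_pi
      nlinarith [sq_nonneg (y - 1)]
    _ = _ := Real.exp_add _ _

/-- The contribution of the two terms `n = 0` and `n = -1` to the theta function; these are the
only ones that fail to decay uniformly as `c` approaches `0` or `1`. -/
noncomputable def lerchMain (k : ℕ) (a c t : ℝ) : ℂ :=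
  ((c ^ k * Real.exp (-Real.pi * c ^ 2 * t) : ℝ) : ℂ) +
    (-1) ^ k * Complex.exp (-2 * Real.pi * Complex.I * a) *
      (((1 - c) ^ k * Real.exp (-Real.pi * (1 - c) ^ 2 * t) : ℝ) : ℂ)

lemma norm_lerchMain_le (k : ℕ) (a t : ℝ) {c : ℝ} (hc : c ∈ Ioo (0 : ℝ) 1) :
    ‖lerchMain k a c t‖ ≤ c ^ k * Real.exp (-Real.pi * c ^ 2 * t) +
      (1 - c) ^ k * Real.exp (-Real.pi * (1 - c) ^ 2 * t) := by
  have h1 : 0 ≤ c := hc.1.le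
  have h2 : 0 ≤ 1 - c := by linarith [hc.2]
  refine (norm_add_le _ _).trans (le_of_eq ?_)
  rw [norm_mul, norm_mul, norm_exp_neg_two_pi_I_mul, norm_pow, norm_neg, norm_one, one_pow,
    one_mul, one_mul, Complex.norm_real, Complex.norm_real, Real.norm_of_nonneg (by positivity),
    Real.norm_of_nonneg (by positivity)]

lemma norm_lerchTheta_sub_main_le {k : ℕ} (hk : k ≤ 1) (a : ℝ) {c t : ℝ}
    (hc : c ∈ Ioo (0 : ℝ) 1) (ht : 1 ≤ t) :
    ‖lerchTheta k a c t - lerchMain k a c t‖ ≤ lerchTailConst * Real.exp (-t) := by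
  set f : ℤ → ℂ := fun n : ℤ => Complex.exp (2 * Real.pi * Complex.I * n * a) *
      (((n + c : ℝ) : ℂ) ^ k * (Real.exp (-Real.pi * (n + c) ^ 2 * t) : ℝ)) with hf
  have h1 : HasSum f (lerchTheta k a c t) := hasSum_lerchTheta hk a c (by linarith)
  set S : Finset ℤ := {0, -1}
  have h2 : HasSum (fun n => if n ∈ S then f n else 0) (lerchMain k a c t) := by
    have : HasSum (fun n => if n ∈ S then f n else 0)
        (∑ n ∈ S, if n ∈ S then f n else 0) :=
      hasSum_sum_of_ne_finset_zero fun b hb => by simp [hb]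
    convert! this using 1
    rw [Finset.sum_congr rfl (g := f) (fun x hx => by simp [hx]),
      Finset.sum_pair (by norm_num)]
    have e : ((-1 : ℤ) : ℝ) + c = -(1 - c) := by push_cast; ring
    simp only [lerchMain]
    rw [e, neg_sq, Complex.ofReal_neg, neg_pow (((1 - c : ℝ) : ℂ))]
    push_cast
    simp only [mul_zero, zero_mul, Complex.exp_zero, zero_add, one_mul]
    rw [show 2 * Real.pi * Complex.I * (-1) * a = -2 * Real.pi * Complex.I * a by ring]
    ring
  have h3 := h1.sub h2
  rw [← h3.tsum_eq]
  refine tsum_of_norm_bounded (summable_exp_neg_abs_half.hasSum.mul_right _) fun n => ?_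
  by_cases hn : n ∈ S
  · simp only [hn, if_true, sub_self, norm_zero]; positivity
  · simp only [hn, if_false, sub_zero, hf]
    rw [norm_mul, norm_exp_two_pi_I_mul, one_mul, norm_mul, norm_pow, Complex.norm_real,
      Complex.norm_real, Real.norm_of_nonneg (Real.exp_pos _).le, Real.norm_eq_abs,
      ← sq_abs ((n : ℝ) + c)]
    have hn' : 1 ≤ n ∨ n ≤ -2 := by
      simp only [S, Finset.mem_insert, Finset.mem_singleton, not_or] at hn; omega
    have key : 1 ≤ |(n : ℝ) + c| ∧ |(n : ℝ)| / 2 ≤ |(n : ℝ) + c| := by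
      obtain ⟨hc0, hc1⟩ := hc
      rcases hn' with h | h
      · have h' : (1 : ℝ) ≤ n := by exact_mod_cast h
        rw [abs_of_pos (by linarith), abs_of_pos (by linarith)]
        constructor <;> linarith
      · have h' : (n : ℝ) ≤ -2 := by exact_mod_cast h
        rw [abs_of_neg (by linarith), abs_of_neg (by linarith)]
        constructor <;> linarith
    refine (pow_mul_exp_le hk key.1 ht).trans ?_
    rw [mul_comm]
    gcongr
    exact key.2

/-- A theta function with non-integral shift decays exponentially. -/
lemma lerchTheta_isBigO {k : ℕ} (hk : k ≤ 1) (a : ℝ) {c : ℝ} (hc : c ∈ Ioo (0 : ℝ) 1) (r : ℝ) :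
    (fun t => lerchTheta k a c t) =O[Filter.atTop] fun t => t ^ r := by
  have key {b : ℝ} (hb : 0 < b) :
      (fun t => Real.exp (-b * t)) =O[Filter.atTop] fun t => t ^ r :=
    (isLittleO_exp_neg_mul_rpow_atTop hb r).isBigO
  have hc1 : 0 < 1 - c := by linarith [hc.2]
  have h : (fun t => lerchTheta k a c t) =O[Filter.atTop] fun t =>
      lerchTailConst * Real.exp (-1 * t) + (c ^ k * Real.exp (-(Real.pi * c ^ 2) * t) +
        (1 - c) ^ k * Real.exp (-(Real.pi * (1 - c) ^ 2) * t)) := by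
    refine Asymptotics.IsBigO.of_bound 1 ?_
    filter_upwards [Filter.eventually_ge_atTop 1] with t ht
    have h1 := norm_lerchTheta_sub_main_le hk a hc ht
    have h2 := norm_lerchMain_le k a t hc
    have h3 := norm_add_le (lerchTheta k a c t - lerchMain k a c t) (lerchMain k a c t)
    rw [sub_add_cancel] at h3
    rw [one_mul]
    refine le_trans ?_ (Real.le_norm_self _)
    simp only [neg_mul, one_mul] at h1 h2 ⊢
    linarith
  refine h.trans ?_
  exact ((key one_pos).const_mul_left _).add (((key (by positivity [hc.1])).const_mul_left _).add
    ((key (by positivity)).const_mul_left _))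

/-! ### The completed Lerch function -/

lemma continuousOn_lerchTheta {k : ℕ} (hk : k ≤ 1) (a c : ℝ) :
    ContinuousOn (lerchTheta k a c) (Ioi 0) := fun t ht =>
  (ContinuousAt.comp (f := fun t : ℝ => (a, c, t))
    (g := fun x : ℝ × ℝ × ℝ => lerchTheta k x.1 x.2.1 x.2.2)
    (continuousAt_lerchTheta hk (a, c, t) ht) (by fun_prop)).continuousWithinAt

lemma one_sub_mem_Ioo {x : ℝ} (hx : x ∈ Ioo (0 : ℝ) 1) : 1 - x ∈ Ioo (0 : ℝ) 1 :=
  ⟨by linarith [hx.2], by linarith [hx.1]⟩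

/-- The theta functions for `(a, c)` and `(1 - c, a)` as a pair related by a functional
equation. -/
noncomputable def lerchFEPair {k : ℕ} (hk : k ≤ 1) {a c : ℝ} (ha : a ∈ Ioo (0 : ℝ) 1)
    (hc : c ∈ Ioo (0 : ℝ) 1) : WeakFEPair ℂ where
  f := lerchTheta k a c
  g := lerchTheta k (1 - c) a
  k := k + 1 / 2
  ε := Complex.I ^ k * Complex.exp (-2 * Real.pi * Complex.I * a * c)
  f₀ := 0
  g₀ := 0
  hf_int := (continuousOn_lerchTheta hk a c).locallyIntegrableOn measurableSet_Ioi
  hg_int := (continuousOn_lerchTheta hk (1 - c) a).locallyIntegrableOn measurableSet_Ioi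
  hk := by positivity
  hε := mul_ne_zero (pow_ne_zero _ Complex.I_ne_zero) (Complex.exp_ne_zero _)
  h_feq t ht := by
    rw [lerchTheta_functional_equation hk a c ht, smul_eq_mul]
  hf_top r := by simpa using lerchTheta_isBigO hk a hc r
  hg_top r := by simpa using lerchTheta_isBigO hk (1 - c) ha r

lemma isStrongFEPair_lerchFEPair {k : ℕ} (hk : k ≤ 1) {a c : ℝ} (ha : a ∈ Ioo (0 : ℝ) 1)
    (hc : c ∈ Ioo (0 : ℝ) 1) : IsStrongFEPair (lerchFEPair hk ha hc) := ⟨rfl, rfl⟩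

/-- The completed Lerch function of parity `k`, the Mellin transform of the theta function. -/
noncomputable def lerchCompleted (k : ℕ) (s : ℂ) (a c : ℝ) : ℂ :=
  mellin (lerchTheta k a c) ((s + k) / 2)

/-- The Lerch function of parity `k`, which continues
`∑_{n ∈ ℤ} sgn(n + c)^k e^{2π i n a} |n + c|^{-s}`. -/
noncomputable def lerchParity (k : ℕ) (s : ℂ) (a c : ℝ) : ℂ :=
  (Complex.Gammaℝ (s + k))⁻¹ * lerchCompleted k s a c

lemma differentiable_lerchParity {k : ℕ} (hk : k ≤ 1) {a c : ℝ} (ha : a ∈ Ioo (0 : ℝ) 1)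
    (hc : c ∈ Ioo (0 : ℝ) 1) : Differentiable ℂ fun s => lerchParity k s a c := by
  have h : Differentiable ℂ (mellin (lerchTheta k a c)) := by
    have := (isStrongFEPair_lerchFEPair hk ha hc).differentiable_Λ
    rwa [(isStrongFEPair_lerchFEPair hk ha hc).Λ_eq] at this
  refine Differentiable.mul (Complex.differentiable_Gammaℝ_inv.comp
    (differentiable_id.add_const _)) (h.comp ?_)
  fun_prop

lemma mellinConvergent_lerchTheta {k : ℕ} (hk : k ≤ 1) {a c : ℝ} (ha : a ∈ Ioo (0 : ℝ) 1)
    (hc : c ∈ Ioo (0 : ℝ) 1) (s : ℂ) : MellinConvergent (lerchTheta k a c) s :=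
  ((isStrongFEPair_lerchFEPair hk ha hc).hasMellin s).1

lemma lerchCompleted_functional_equation {k : ℕ} (hk : k ≤ 1) (s : ℂ) {a c : ℝ}
    (ha : a ∈ Ioo (0 : ℝ) 1) (hc : c ∈ Ioo (0 : ℝ) 1) :
    lerchCompleted k s a c = Complex.I ^ k * Complex.exp (-2 * Real.pi * Complex.I * a * c) *
      lerchCompleted k (1 - s) (1 - c) a := by
  have hP := isStrongFEPair_lerchFEPair hk ha hc
  have h := (lerchFEPair hk ha hc).functional_equation ((1 - s + k) / 2)
  rw [hP.Λ_eq, hP.symm.Λ_eq] at h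
  have e : ((lerchFEPair hk ha hc).k : ℂ) - (1 - s + k) / 2 = (s + k) / 2 := by
    simp only [lerchFEPair]; push_cast; ring
  rw [e] at h
  exact h

lemma lerchCompleted_one_sub (k : ℕ) (s : ℂ) (a c : ℝ) :
    Complex.exp (-2 * Real.pi * Complex.I * a) * lerchCompleted k s (1 - a) (1 - c) =
      (-1) ^ k * lerchCompleted k s a c := by
  have h (b : ℂ) (f : ℝ → ℂ) (z : ℂ) : b * mellin f z = mellin (fun t => b * f t) z := by
    simpa using (mellin_const_smul f z b).symm
  rw [lerchCompleted, lerchCompleted, h, h]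
  simp_rw [lerchTheta_one_sub]

lemma lerchParity_one_sub (k : ℕ) (s : ℂ) (a c : ℝ) :
    Complex.exp (-2 * Real.pi * Complex.I * a) * lerchParity k s (1 - a) (1 - c) =
      (-1) ^ k * lerchParity k s a c := by
  simp only [lerchParity]
  linear_combination (Complex.Gammaℝ (s + k))⁻¹ * lerchCompleted_one_sub k s a c

/-! ### The Lerch zeta function in terms of its even and odd parts -/

lemma int_add_ne_zero {c : ℝ} (hc : c ∈ Ioo (0 : ℝ) 1) (n : ℤ) : (n : ℝ) + c ≠ 0 := by
  intro h
  have h1 : (n : ℝ) < 0 := by linarith [hc.1]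
  have h2 : (-1 : ℝ) < n := by linarith [hc.2]
  have h1' : n < 0 := by exact_mod_cast h1
  have h2' : -1 < n := by exact_mod_cast h2
  omega

lemma hasSum_lerchParity_zero (a : ℝ) {c : ℝ} (hc : c ∈ Ioo (0 : ℝ) 1) {s : ℂ} (hs : 1 < s.re) :
    HasSum (fun n : ℤ => Complex.exp (2 * Real.pi * Complex.I * n * a) / (|n + c| : ℝ) ^ s)
      (lerchParity 0 s a c) := by
  have hG : Complex.Gammaℝ s ≠ 0 := Complex.Gammaℝ_ne_zero_of_re_pos (by linarith)
  have h := hasSum_mellin_pi_mul_sq (a := fun n : ℤ =>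
      Complex.exp (2 * Real.pi * Complex.I * n * a)) (r := fun n : ℤ => (n : ℝ) + c)
      (F := lerchTheta 0 a c) (s := s) (by linarith) (fun t ht => by
        simp only [int_add_ne_zero hc, if_false]
        simpa using hasSum_lerchTheta zero_le_one a c ht) (by
        simp_rw [norm_exp_two_pi_I_mul]
        exact (Real.summable_one_div_int_add_rpow c s.re).mpr hs)
  have h' := h.mul_left (Complex.Gammaℝ s)⁻¹
  convert! h' using 2
  · rw [mul_div_assoc, inv_mul_cancel_left₀ hG]
  · simp [lerchParity, lerchCompleted]

lemma hasSum_lerchParity_one (a c : ℝ) {s : ℂ} (hs : 1 < s.re) :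
    HasSum (fun n : ℤ => Complex.exp (2 * Real.pi * Complex.I * n * a) *
      SignType.sign ((n : ℝ) + c) / (|n + c| : ℝ) ^ s) (lerchParity 1 s a c) := by
  have hG : Complex.Gammaℝ (s + 1) ≠ 0 :=
    Complex.Gammaℝ_ne_zero_of_re_pos (by simp; linarith)
  have h := hasSum_mellin_pi_mul_sq' (a := fun n : ℤ =>
      Complex.exp (2 * Real.pi * Complex.I * n * a)) (r := fun n : ℤ => (n : ℝ) + c)
      (F := lerchTheta 1 a c) (s := s) (by linarith) (fun t ht => by
        simpa [mul_assoc] using hasSum_lerchTheta le_rfl a c ht) (by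
        simp_rw [norm_exp_two_pi_I_mul]
        exact (Real.summable_one_div_int_add_rpow c s.re).mpr hs)
  have h' := h.mul_left (Complex.Gammaℝ (s + 1))⁻¹
  convert! h' using 2
  · field_simp
  · simp [lerchParity, lerchCompleted]

/-- Averaging the even and the odd series retains exactly the terms with `n ≥ 0`. -/
lemma isLerchContinuation_lerchParity {a c : ℝ} (ha : a ∈ Ioo (0 : ℝ) 1)
    (hc : c ∈ Ioo (0 : ℝ) 1) :
    IsLerchContinuation a c fun s => (lerchParity 0 s a c + lerchParity 1 s a c) / 2 := by
  refine ⟨((differentiable_lerchParity zero_le_one ha hc).add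
    (differentiable_lerchParity le_rfl ha hc)).div_const _, fun s hs => ?_⟩
  have h := ((hasSum_lerchParity_zero a hc hs).add (hasSum_lerchParity_one a c hs)).div_const 2
  rw [← (Nat.cast_injective (R := ℤ)).hasSum_iff] at h
  · convert! h using 2 with n
    have hn : (0 : ℝ) < n + c := by have := hc.1; positivity
    simp only [Function.comp_apply, Int.cast_natCast]
    rw [sign_pos hn, abs_of_pos hn, Complex.cpow_neg, SignType.coe_one]
    push_cast
    ring
  · intro n hn
    have hn' : n < 0 := by
      by_contra hcon
      exact hn ⟨n.toNat, Int.toNat_of_nonneg (by omega)⟩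
    have hn1 : (n : ℝ) ≤ -1 := by exact_mod_cast Int.le_sub_one_of_lt hn'
    rw [sign_neg (by linarith [hc.2]), SignType.coe_neg, SignType.coe_one]
    ring

lemma IsLerchContinuation.unique {a c : ℝ} {f g : ℂ → ℂ} (hf : IsLerchContinuation a c f)
    (hg : IsLerchContinuation a c g) : f = g := by
  refine AnalyticOnNhd.eq_of_eventuallyEq (𝕜 := ℂ) (z₀ := 2)
    (hf.1.differentiableOn.analyticOnNhd isOpen_univ)
    (hg.1.differentiableOn.analyticOnNhd isOpen_univ) ?_
  have : ∀ᶠ s : ℂ in nhds 2, 1 < s.re :=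
    Complex.continuous_re.continuousAt.eventually (lt_mem_nhds (by norm_num))
  filter_upwards [this] with s hs using (hf.2 s hs).unique (hg.2 s hs)

lemma lerchZeta_eq (s : ℂ) {a c : ℝ} (ha : a ∈ Ioo (0 : ℝ) 1) (hc : c ∈ Ioo (0 : ℝ) 1) :
    lerchZeta s a c = (lerchParity 0 s a c + lerchParity 1 s a c) / 2 := by
  have h := isLerchContinuation_lerchParity ha hc
  have hex : ∃ f, IsLerchContinuation a c f := ⟨_, h⟩
  rw [lerchZeta, dif_pos hex, hex.choose_spec.unique h]

lemma lerchLPlus_eq (s : ℂ) {a c : ℝ} (ha : a ∈ Ioo (0 : ℝ) 1) (hc : c ∈ Ioo (0 : ℝ) 1) :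
    lerchLPlus s a c = lerchParity 0 s a c := by
  rw [lerchLPlus, lerchZeta_eq s ha hc, lerchZeta_eq s (one_sub_mem_Ioo ha) (one_sub_mem_Ioo hc)]
  linear_combination (lerchParity_one_sub 0 s a c + lerchParity_one_sub 1 s a c) / 2

lemma lerchLMinus_eq (s : ℂ) {a c : ℝ} (ha : a ∈ Ioo (0 : ℝ) 1) (hc : c ∈ Ioo (0 : ℝ) 1) :
    lerchLMinus s a c = lerchParity 1 s a c := by
  rw [lerchLMinus, lerchZeta_eq s ha hc, lerchZeta_eq s (one_sub_mem_Ioo ha) (one_sub_mem_Ioo hc)]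
  linear_combination -(lerchParity_one_sub 0 s a c + lerchParity_one_sub 1 s a c) / 2

/-- For `Re s > 0` the Gamma factor of `s` is finite and nonzero, so the dual function is a
multiple (possibly zero) of the original one. -/
lemma exists_dual_lerchParity_eq {k : ℕ} (hk : k ≤ 1) {s : ℂ} (hs : 0 < s.re) :
    ∃ b : ℂ, ∀ a ∈ Ioo (0 : ℝ) 1, ∀ c ∈ Ioo (0 : ℝ) 1,
      Complex.exp (-2 * Real.pi * Complex.I * a * c) * lerchParity k (1 - s) (1 - c) a =
        b * lerchParity k s a c := by
  have hG : Complex.Gammaℝ (s + k) ≠ 0 :=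
    Complex.Gammaℝ_ne_zero_of_re_pos (by simp; positivity)
  have hI : Complex.I ^ k ≠ 0 := pow_ne_zero _ Complex.I_ne_zero
  refine ⟨(Complex.Gammaℝ (1 - s + k))⁻¹ * Complex.Gammaℝ (s + k) / Complex.I ^ k,
    fun a ha c hc => ?_⟩
  rw [lerchParity, lerchParity, lerchCompleted_functional_equation hk s ha hc]
  field_simp

/-! ### Boundary behaviour for `Re s > 0` -/

lemma integrableOn_rpow_mul_exp_neg_div {u b : ℝ} (hu : 0 < u) (hb : 0 < b) :
    IntegrableOn (fun t : ℝ => t ^ (-u - 1) * Real.exp (-b / t)) (Ioi 0) ∧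
      ∫ t in Ioi (0 : ℝ), t ^ (-u - 1) * Real.exp (-b / t) = b ^ (-u) * Real.Gamma u := by
  have hcongr : EqOn (fun t : ℝ => (|(-1 : ℝ)| * t ^ ((-1 : ℝ) - 1)) •
      ((t ^ (-1 : ℝ)) ^ (u - 1) * Real.exp (-(b * t ^ (-1 : ℝ)))))
      (fun t : ℝ => t ^ (-u - 1) * Real.exp (-b / t)) (Ioi 0) := by
    intro t (ht : 0 < t)
    simp only [smul_eq_mul, abs_neg, abs_one, one_mul]
    rw [← Real.rpow_mul ht.le, ← mul_assoc, ← Real.rpow_add ht, Real.rpow_neg_one]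
    congr 2
    · ring
    · rw [div_eq_mul_inv]; ring
  constructor
  · refine IntegrableOn.congr_fun ?_ hcongr measurableSet_Ioi
    refine (integrableOn_Ioi_comp_rpow_iff
      (fun y : ℝ => y ^ (u - 1) * Real.exp (-(b * y))) (by norm_num : (-1 : ℝ) ≠ 0)).mpr ?_
    simpa using integrableOn_rpow_mul_exp_neg_mul_rpow (s := u - 1) (p := 1) (b := b)
      (by linarith) one_pos hb
  · rw [← setIntegral_congr_fun measurableSet_Ioi hcongr, integral_comp_rpow_Ioi
      (fun y : ℝ => y ^ (u - 1) * Real.exp (-(b * y))) (by norm_num : (-1 : ℝ) ≠ 0),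
      Real.integral_rpow_mul_exp_neg_mul_Ioi hu hb, one_div, Real.inv_rpow hb.le,
      Real.rpow_neg hb.le]

lemma hasMellin_pow_mul_exp (k : ℕ) {s : ℂ} (hs : 0 < s.re) {x : ℝ} (hx : 0 < x) :
    HasMellin (fun t : ℝ => ((x ^ k * Real.exp (-Real.pi * x ^ 2 * t) : ℝ) : ℂ)) ((s + k) / 2)
      (Complex.Gammaℝ (s + k) * (x : ℂ) ^ (-s)) := by
  have hsk : 0 < (s + k).re := by simp; positivity
  have hxc : (x : ℂ) ≠ 0 := by exact_mod_cast hx.ne'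
  have h := hasSum_mellin_pi_mul_sq (ι := Unit) (a := fun _ => (x : ℂ) ^ k) (r := fun _ => x)
    (F := fun t : ℝ => ((x ^ k * Real.exp (-Real.pi * x ^ 2 * t) : ℝ) : ℂ)) hsk
    (fun t _ => by simp [hx.ne'])
    (hasSum_unique _).summable
  have h2 := h.unique (hasSum_unique _)
  have h3 : Complex.Gammaℝ (s + k) * (x : ℂ) ^ k / ((|x| : ℝ) : ℂ) ^ (s + k) =
      Complex.Gammaℝ (s + k) * (x : ℂ) ^ (-s) := by
    rw [abs_of_pos hx, Complex.cpow_add _ _ hxc, Complex.cpow_natCast, Complex.cpow_neg]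
    field_simp
  have h4 := h2.trans h3
  refine ⟨?_, h4⟩
  -- a nonzero integral certifies integrability
  by_contra hcon
  have h5 : mellin (fun t : ℝ => ((x ^ k * Real.exp (-Real.pi * x ^ 2 * t) : ℝ) : ℂ))
      ((s + k) / 2) = 0 := integral_undef hcon
  rw [h4] at h5
  exact mul_ne_zero (Complex.Gammaℝ_ne_zero_of_re_pos hsk) (by simp [Complex.cpow_eq_zero_iff, hxc])
    h5

/-- The boundary terms of the Lerch function of parity `k` on the sides `c = 0` and `c = 1`. -/
noncomputable def lerchBoundary (k : ℕ) (s : ℂ) (a c : ℝ) : ℂ :=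
  (c : ℂ) ^ (-s) + (-1) ^ k * Complex.exp (-2 * Real.pi * Complex.I * a) *
    ((1 - c : ℝ) : ℂ) ^ (-s)

lemma hasMellin_lerchMain (k : ℕ) {s : ℂ} (hs : 0 < s.re) (a : ℝ) {c : ℝ}
    (hc : c ∈ Ioo (0 : ℝ) 1) :
    HasMellin (lerchMain k a c) ((s + k) / 2)
      (Complex.Gammaℝ (s + k) * lerchBoundary k s a c) := by
  have h1 := hasMellin_pow_mul_exp k hs hc.1
  have h2 := hasMellin_pow_mul_exp k hs (one_sub_mem_Ioo hc).1
  have h3 := hasMellin_const_smul h2.1 ((-1) ^ k * Complex.exp (-2 * Real.pi * Complex.I * a))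
  have h4 := hasMellin_add h1.1 h3.1
  rw [h1.2, h3.2, h2.2] at h4
  convert! h4 using 1
  simp only [lerchBoundary, smul_eq_mul]
  ring

/-- The functional equation turns the decay of the dual theta function at `∞` into a bound near
`t = 0`. -/
lemma norm_lerchTheta_le_of_le_one {k : ℕ} (hk : k ≤ 1) {a : ℝ} (ha : a ∈ Ioo (0 : ℝ) 1) (c : ℝ)
    {t : ℝ} (ht : 0 < t) (ht1 : t ≤ 1) :
    ‖lerchTheta k a c t‖ ≤ t ^ (-(k + 1 / 2 : ℝ)) *
      (a ^ k * Real.exp (-(Real.pi * a ^ 2) / t) +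
        (1 - a) ^ k * Real.exp (-(Real.pi * (1 - a) ^ 2) / t) +
        lerchTailConst * Real.exp (-1 / t)) := by
  have htinv : 0 < 1 / t := by positivity
  have h := lerchTheta_functional_equation hk a c htinv
  rw [one_div_one_div] at h
  rw [h, norm_mul, norm_mul, norm_mul, norm_pow, Complex.norm_I, one_pow, one_mul]
  have e1 : ‖Complex.exp (-2 * Real.pi * Complex.I * a * c)‖ = 1 := by
    simpa [mul_assoc] using norm_exp_neg_two_pi_I_mul (a * c)
  rw [e1, one_mul, Complex.norm_real, Real.norm_of_nonneg (by positivity), one_div,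
    Real.inv_rpow ht.le, ← Real.rpow_neg ht.le]
  have h1 := norm_lerchTheta_sub_main_le hk (1 - c) ha ((one_le_inv₀ ht).mpr ht1)
  have h2 := norm_lerchMain_le k (1 - c) t⁻¹ ha
  have h3 := norm_add_le (lerchTheta k (1 - c) a t⁻¹ - lerchMain k (1 - c) a t⁻¹)
    (lerchMain k (1 - c) a t⁻¹)
  rw [sub_add_cancel] at h3
  refine mul_le_mul_of_nonneg_left ?_ (by positivity)
  simp only [div_eq_mul_inv, neg_mul, one_mul] at h1 h2 ⊢
  linarith

lemma norm_lerchMain_le_two {k : ℕ} (a : ℝ) {c t : ℝ} (hc : c ∈ Ioo (0 : ℝ) 1) (ht : 0 < t) :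
    ‖lerchMain k a c t‖ ≤ 2 := by
  have key {x : ℝ} (hx : x ∈ Ioo (0 : ℝ) 1) :
      x ^ k * Real.exp (-Real.pi * x ^ 2 * t) ≤ 1 := by
    refine mul_le_one₀ (pow_le_one₀ hx.1.le hx.2.le) (Real.exp_pos _).le ?_
    rw [Real.exp_le_one_iff]
    have : 0 ≤ Real.pi * x ^ 2 * t := by positivity
    linarith
  have h := norm_lerchMain_le k a t hc
  linarith [key hc, key (one_sub_mem_Ioo hc)]

/-- An integrable majorant for the Mellin integrand of `lerchTheta - lerchMain`. The first summand
controls `t ≥ 1` and, for `t ≤ 1`, the part `lerchMain`; the second controls `lerchTheta` for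
`t ≤ 1`, through the functional equation. -/
lemma norm_cpow_mul_lerchTheta_sub_main_le {k : ℕ} (hk : k ≤ 1) {s : ℂ} {τ : ℝ}
    (hτ : τ ≤ s.re) {a c : ℝ} (ha : a ∈ Ioo (0 : ℝ) 1) (hc : c ∈ Ioo (0 : ℝ) 1) {t : ℝ}
    (ht : 0 < t) :
    ‖(t : ℂ) ^ ((s + k) / 2 - 1) • (lerchTheta k a c t - lerchMain k a c t)‖ ≤
      (lerchTailConst + 6) * (t ^ ((s.re + k) / 2 - 1) * Real.exp (-t)) +
        (a ^ k * (t ^ (-((k + 1 - τ) / 2) - 1) * Real.exp (-(Real.pi * a ^ 2) / t)) +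
          (1 - a) ^ k *
            (t ^ (-((k + 1 - τ) / 2) - 1) * Real.exp (-(Real.pi * (1 - a) ^ 2) / t)) +
          lerchTailConst * (t ^ (-((k + 1 - τ) / 2) - 1) * Real.exp (-1 / t))) := by
  have hA := lerchTailConst_nonneg
  have ha0 := ha.1
  have ha1 : 0 < 1 - a := (one_sub_mem_Ioo ha).1
  rw [norm_smul, Complex.norm_cpow_eq_rpow_re_of_pos ht]
  have ere : ((s + k) / 2 - 1).re = (s.re + k) / 2 - 1 := by simp
  rw [ere]
  have hp : 0 < t ^ ((s.re + k) / 2 - 1) := by positivity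
  rcases le_total 1 t with h1 | h1
  · have h := norm_lerchTheta_sub_main_le hk a hc h1
    calc _ ≤ t ^ ((s.re + k) / 2 - 1) * (lerchTailConst * Real.exp (-t)) := by gcongr
      _ ≤ (lerchTailConst + 6) * (t ^ ((s.re + k) / 2 - 1) * Real.exp (-t)) := by
        have : 0 ≤ t ^ ((s.re + k) / 2 - 1) * Real.exp (-t) := by positivity
        nlinarith
      _ ≤ _ := le_add_of_nonneg_right (by positivity)
  · have h2 := norm_lerchTheta_le_of_le_one hk ha c ht h1
    -- the constant `6` is an upper bound for `2 * e`
    have h3 : ‖lerchMain k a c t‖ ≤ 6 * Real.exp (-t) := by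
      refine (norm_lerchMain_le_two a hc ht).trans ?_
      have h4 : Real.exp (-1) ≤ Real.exp (-t) := Real.exp_le_exp.mpr (by linarith)
      have h5 : 1 / 3 ≤ Real.exp (-1) := by
        rw [Real.exp_neg, one_div]
        exact inv_anti₀ (Real.exp_pos 1) (Real.exp_one_lt_d9.le.trans (by norm_num))
      linarith
    set B := a ^ k * Real.exp (-(Real.pi * a ^ 2) / t) +
        (1 - a) ^ k * Real.exp (-(Real.pi * (1 - a) ^ 2) / t) +
        lerchTailConst * Real.exp (-1 / t) with hB
    have hB0 : 0 ≤ B := by positivity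
    have h6 : t ^ ((s.re + k) / 2 - 1) * t ^ (-(k + 1 / 2 : ℝ)) ≤
        t ^ (-((k + 1 - τ) / 2) - 1) := by
      rw [← Real.rpow_add ht]
      exact Real.rpow_le_rpow_of_exponent_ge ht h1 (by linarith)
    calc _ ≤ t ^ ((s.re + k) / 2 - 1) * (t ^ (-(k + 1 / 2 : ℝ)) * B + 6 * Real.exp (-t)) := by
          gcongr
          exact (norm_sub_le _ _).trans (add_le_add h2 h3)
      _ = 6 * (t ^ ((s.re + k) / 2 - 1) * Real.exp (-t)) +
          (t ^ ((s.re + k) / 2 - 1) * t ^ (-(k + 1 / 2 : ℝ))) * B := by ring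
      _ ≤ (lerchTailConst + 6) * (t ^ ((s.re + k) / 2 - 1) * Real.exp (-t)) +
          t ^ (-((k + 1 - τ) / 2) - 1) * B := by
        gcongr
        linarith
      _ = _ := by rw [hB]; ring

lemma norm_lerchCompleted_sub_le {k : ℕ} (hk : k ≤ 1) {s : ℂ} (hs : 0 < s.re) {τ : ℝ}
    (hτ : τ ≤ s.re) (hτ1 : τ < 1) {a c : ℝ} (ha : a ∈ Ioo (0 : ℝ) 1) (hc : c ∈ Ioo (0 : ℝ) 1) :
    ‖lerchCompleted k s a c - Complex.Gammaℝ (s + k) * lerchBoundary k s a c‖ ≤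
      (lerchTailConst + 6) * Real.Gamma ((s.re + k) / 2) +
        Real.Gamma ((k + 1 - τ) / 2) * (Real.pi ^ (-((k + 1 - τ) / 2)) *
          (a ^ (τ - 1) + (1 - a) ^ (τ - 1)) + lerchTailConst) := by
  have ha0 := ha.1
  have ha1 : 0 < 1 - a := (one_sub_mem_Ioo ha).1
  have hm := hasMellin_lerchMain k hs a hc
  have hd := hasMellin_sub (mellinConvergent_lerchTheta hk ha hc ((s + k) / 2)) hm.1
  have hu : 0 < (k + 1 - τ) / 2 := by
    have : (0 : ℝ) ≤ k := k.cast_nonneg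
    linarith
  have hv : 0 < (s.re + k) / 2 := by positivity
  have i1 : IntegrableOn (fun t : ℝ => t ^ ((s.re + k) / 2 - 1) * Real.exp (-t)) (Ioi 0) := by
    simpa using integrableOn_rpow_mul_exp_neg_mul_rpow (s := (s.re + k) / 2 - 1) (p := 1) (b := 1)
      (by linarith) one_pos one_pos
  have v1 : ∫ t in Ioi (0 : ℝ), t ^ ((s.re + k) / 2 - 1) * Real.exp (-t) =
      Real.Gamma ((s.re + k) / 2) := by
    simpa using Real.integral_rpow_mul_exp_neg_mul_Ioi hv one_pos
  obtain ⟨i2, v2⟩ := integrableOn_rpow_mul_exp_neg_div hu (b := Real.pi * a ^ 2) (by positivity)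
  obtain ⟨i3, v3⟩ := integrableOn_rpow_mul_exp_neg_div hu (b := Real.pi * (1 - a) ^ 2)
    (by positivity)
  obtain ⟨i4, v4⟩ := integrableOn_rpow_mul_exp_neg_div hu one_pos
  rw [hm.2] at hd
  rw [lerchCompleted, ← hd.2, mellin]
  refine (norm_integral_le_of_norm_le (((i1.const_mul _).add (((i2.const_mul _).add
    (i3.const_mul _)).add (i4.const_mul _))))
    ((ae_restrict_iff' measurableSet_Ioi).mpr (Filter.Eventually.of_forall fun t ht =>
      norm_cpow_mul_lerchTheta_sub_main_le hk hτ ha hc ht))).trans (le_of_eq ?_)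
  have hpow {x : ℝ} (hx : 0 < x) : x ^ k * (Real.pi * x ^ 2) ^ (-((k + 1 - τ) / 2)) =
      Real.pi ^ (-((k + 1 - τ) / 2)) * x ^ (τ - 1) := by
    rw [Real.mul_rpow Real.pi_pos.le (by positivity), ← Real.rpow_natCast x 2, ← Real.rpow_mul hx.le,
      mul_left_comm, ← Real.rpow_natCast x k, ← Real.rpow_add hx]
    congr 2
    push_cast
    ring
  simp only [Pi.add_apply]
  rw [integral_add, integral_add, integral_add]
  rotate_left
  · exact i2.const_mul _
  · exact i3.const_mul _
  · exact (i2.const_mul _).add (i3.const_mul _)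
  · exact i4.const_mul _
  · exact i1.const_mul _
  · exact ((i2.const_mul _).add (i3.const_mul _)).add (i4.const_mul _)
  simp only [integral_const_mul]
  rw [v1, v2, v3, v4, Real.one_rpow]
  linear_combination Real.Gamma ((k + 1 - τ) / 2) * (hpow ha0 + hpow ha1)

/-- Up to a multiple of `1 + a^{τ - 1} + (1 - a)^{τ - 1}`, the Lerch function of parity `k` equals
its boundary terms on the sides `c = 0` and `c = 1`. -/
lemma exists_norm_lerchParity_sub_le {k : ℕ} (hk : k ≤ 1) {s : ℂ} (hs : 0 < s.re) {τ : ℝ}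
    (hτ : τ ≤ s.re) (hτ1 : τ < 1) :
    ∃ C, 0 ≤ C ∧ ∀ a ∈ Ioo (0 : ℝ) 1, ∀ c ∈ Ioo (0 : ℝ) 1,
      ‖lerchParity k s a c - lerchBoundary k s a c‖ ≤
        C * (1 + a ^ (τ - 1) + (1 - a) ^ (τ - 1)) := by
  have hG : Complex.Gammaℝ (s + k) ≠ 0 :=
    Complex.Gammaℝ_ne_zero_of_re_pos (by simp; positivity)
  have hA := lerchTailConst_nonneg
  have hk0 : (0 : ℝ) ≤ k := k.cast_nonneg
  set g := Real.Gamma ((k + 1 - τ) / 2)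
  have hg : 0 < g := Real.Gamma_pos_of_pos (by linarith)
  set g' := Real.Gamma ((s.re + k) / 2)
  have hg' : 0 < g' := Real.Gamma_pos_of_pos (by positivity)
  set q := Real.pi ^ (-((k + 1 - τ) / 2))
  have hq : 0 < q := by positivity
  refine ⟨‖(Complex.Gammaℝ (s + k))⁻¹‖ * ((lerchTailConst + 6) * g' + g * lerchTailConst + g * q),
    by positivity, fun a ha c hc => ?_⟩
  have h := norm_lerchCompleted_sub_le hk hs hτ hτ1 ha hc
  have ha0 := ha.1
  have ha1 : 0 < 1 - a := (one_sub_mem_Ioo ha).1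
  have e : lerchParity k s a c - lerchBoundary k s a c = (Complex.Gammaℝ (s + k))⁻¹ *
      (lerchCompleted k s a c - Complex.Gammaℝ (s + k) * lerchBoundary k s a c) := by
    rw [lerchParity, mul_sub, inv_mul_cancel_left₀ hG]
  rw [e, norm_mul, mul_assoc]
  gcongr
  refine h.trans ?_
  set X := a ^ (τ - 1) + (1 - a) ^ (τ - 1) with hX
  have hX0 : 0 ≤ X := by positivity
  rw [add_assoc 1, ← hX]
  have h1 : 0 ≤ ((lerchTailConst + 6) * g' + g * lerchTailConst) * X := by positivity
  have h2 : 0 ≤ g * q := by positivity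
  change (lerchTailConst + 6) * g' + g * (q * X + lerchTailConst) ≤ _
  linarith

/-! ### Measure theory on the unit square -/

lemma volume_restrict_lerchSquare : (volume : Measure (ℝ × ℝ)).restrict lerchSquare =
    ((volume : Measure ℝ).restrict (Icc 0 1)).prod ((volume : Measure ℝ).restrict (Icc 0 1)) := by
  rw [lerchSquare, Measure.prod_restrict, ← Measure.volume_eq_prod]

instance isProbabilityMeasure_restrict_Icc_zero_one :
    IsProbabilityMeasure ((volume : Measure ℝ).restrict (Icc 0 1)) := ⟨by simp⟩

lemma measurePreserving_one_sub_Icc : MeasurePreserving (fun x : ℝ => 1 - x)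
    ((volume : Measure ℝ).restrict (Icc 0 1)) ((volume : Measure ℝ).restrict (Icc 0 1)) := by
  have h := (Measure.measurePreserving_sub_left (volume : Measure ℝ) 1).restrict_preimage
    (s := Icc 0 1) measurableSet_Icc
  have e : (fun x : ℝ => 1 - x) ⁻¹' Icc 0 1 = Icc 0 1 := by
    ext x; simp only [mem_preimage, mem_Icc]; constructor <;> rintro ⟨h1, h2⟩ <;>
      constructor <;> linarith
  rwa [e] at h

lemma measurePreserving_rotate_lerchSquare :
    MeasurePreserving (fun x : ℝ × ℝ => (1 - x.2, x.1))
      ((volume : Measure (ℝ × ℝ)).restrict lerchSquare)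
      ((volume : Measure (ℝ × ℝ)).restrict lerchSquare) := by
  rw [volume_restrict_lerchSquare]
  exact (measurePreserving_one_sub_Icc.prod (MeasurePreserving.id _)).comp
    Measure.measurePreserving_swap

lemma ae_mem_openSquare : ∀ᵐ x ∂((volume : Measure (ℝ × ℝ)).restrict lerchSquare),
    x ∈ Ioo (0 : ℝ) 1 ×ˢ Ioo (0 : ℝ) 1 := by
  rw [volume_restrict_lerchSquare, Measure.restrict_congr_set Ioo_ae_eq_Icc.symm,
    Measure.prod_restrict]
  exact ae_restrict_mem (measurableSet_Ioo.prod measurableSet_Ioo)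

lemma memLp_rpow_Icc {p r : ℝ} (hp : 0 < p) (hr : -1 < r * p) :
    MemLp (fun x : ℝ => x ^ r) (ENNReal.ofReal p) ((volume : Measure ℝ).restrict (Icc 0 1)) := by
  have hm : AEStronglyMeasurable (fun x : ℝ => x ^ r)
      ((volume : Measure ℝ).restrict (Icc 0 1)) :=
    (measurable_id.pow_const r).aestronglyMeasurable
  rw [← integrable_norm_rpow_iff hm (by simpa using hp) ENNReal.ofReal_ne_top,
    ENNReal.toReal_ofReal hp.le, Measure.restrict_congr_set Ioo_ae_eq_Icc.symm]
  refine IntegrableOn.congr_fun ((intervalIntegral.integrableOn_Ioo_rpow_iff one_pos).mpr hr)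
    (fun x hx => ?_) measurableSet_Ioo
  rw [Real.norm_of_nonneg (Real.rpow_nonneg hx.1.le _), ← Real.rpow_mul hx.1.le]

/-! ### The quarter turn exchanging `s` and `1 - s` -/

/-- The operator `(R F)(a, c) = e^{-2π i a c} F(1 - c, a)`, a quarter turn of the square combined
with a unimodular twist. -/
noncomputable def lerchTurn : (ℝ × ℝ → ℂ) →ₗ[ℂ] (ℝ × ℝ → ℂ) where
  toFun F x := Complex.exp (-2 * Real.pi * Complex.I * x.1 * x.2) * F (1 - x.2, x.1)
  map_add' F G := by ext x; simp [mul_add]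
  map_smul' b F := by ext x; simp only [Pi.smul_apply, smul_eq_mul, RingHom.id_apply]; ring

lemma lerchTurn_apply (F : ℝ × ℝ → ℂ) (x : ℝ × ℝ) : lerchTurn F x =
    Complex.exp (-2 * Real.pi * Complex.I * x.1 * x.2) * F (1 - x.2, x.1) := rfl

lemma lerchTurn_lerchTurn_apply (F : ℝ × ℝ → ℂ) (x : ℝ × ℝ) : lerchTurn (lerchTurn F) x =
    Complex.exp (-2 * Real.pi * Complex.I * x.1) * F (1 - x.1, 1 - x.2) := by
  rw [lerchTurn_apply, lerchTurn_apply, ← mul_assoc, ← Complex.exp_add]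
  congr 2
  push_cast
  ring

lemma lerchTurn_iterate_four (F : ℝ × ℝ → ℂ) :
    lerchTurn (lerchTurn (lerchTurn (lerchTurn F))) = F := by
  ext x
  rw [lerchTurn_lerchTurn_apply, lerchTurn_lerchTurn_apply, ← mul_assoc, ← Complex.exp_add]
  have e : -2 * Real.pi * Complex.I * x.1 + -2 * Real.pi * Complex.I * ((1 - x.1 : ℝ) : ℂ) =
      ((-1 : ℤ) : ℂ) * (2 * Real.pi * Complex.I) := by push_cast; ring
  simp only [sub_sub_cancel, e, Complex.exp_int_mul_two_pi_mul_I, one_mul]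

lemma lerchTurn_injective : Function.Injective lerchTurn := fun F G h => by
  rw [← lerchTurn_iterate_four F, h, lerchTurn_iterate_four]

lemma memLp_lerchTurn {F : ℝ × ℝ → ℂ} {p : ℝ≥0∞}
    (hF : MemLp F p ((volume : Measure (ℝ × ℝ)).restrict lerchSquare)) :
    MemLp (lerchTurn F) p ((volume : Measure (ℝ × ℝ)).restrict lerchSquare) := by
  have h := hF.comp_measurePreserving measurePreserving_rotate_lerchSquare
  refine h.congr_norm (AEStronglyMeasurable.mul ?_ h.1)
    (Filter.Eventually.of_forall fun x => ?_)
  · exact Continuous.aestronglyMeasurable (by fun_prop)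
  · have e : ‖Complex.exp (-2 * Real.pi * Complex.I * x.1 * x.2)‖ = 1 := by
      simpa [mul_assoc] using norm_exp_neg_two_pi_I_mul (x.1 * x.2)
    rw [lerchTurn_apply, norm_mul, e, one_mul]
    rfl

lemma memLp_of_memLp_lerchTurn {F : ℝ × ℝ → ℂ} {p : ℝ≥0∞}
    (hF : MemLp (lerchTurn F) p ((volume : Measure (ℝ × ℝ)).restrict lerchSquare)) :
    MemLp F p ((volume : Measure (ℝ × ℝ)).restrict lerchSquare) := by
  rw [← lerchTurn_iterate_four F]
  exact memLp_lerchTurn (memLp_lerchTurn (memLp_lerchTurn hF))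

lemma onOpenSquare_apply (g : ℝ → ℝ → ℂ) {x : ℝ × ℝ}
    (hx : x ∈ Ioo (0 : ℝ) 1 ×ˢ Ioo (0 : ℝ) 1) : onOpenSquare g x = g x.1 x.2 :=
  indicator_of_mem hx _

lemma onOpenSquare_congr {g h : ℝ → ℝ → ℂ}
    (H : ∀ a ∈ Ioo (0 : ℝ) 1, ∀ c ∈ Ioo (0 : ℝ) 1, g a c = h a c) :
    onOpenSquare g = onOpenSquare h :=
  indicator_congr fun x hx => H x.1 hx.1 x.2 hx.2

lemma smul_onOpenSquare (b : ℂ) (g : ℝ → ℝ → ℂ) :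
    b • onOpenSquare g = onOpenSquare fun a c => b * g a c :=
  (indicator_const_smul _ b _).symm

lemma lerchTurn_onOpenSquare (g : ℝ → ℝ → ℂ) : lerchTurn (onOpenSquare g) =
    onOpenSquare fun a c => Complex.exp (-2 * Real.pi * Complex.I * a * c) * g (1 - c) a := by
  ext x
  rw [lerchTurn_apply]
  have hiff : (1 - x.2, x.1) ∈ Ioo (0 : ℝ) 1 ×ˢ Ioo (0 : ℝ) 1 ↔
      x ∈ Ioo (0 : ℝ) 1 ×ˢ Ioo (0 : ℝ) 1 := by
    simp only [mem_prod, mem_Ioo]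
    constructor <;> rintro ⟨⟨h1, h2⟩, h3, h4⟩ <;> refine ⟨⟨?_, ?_⟩, ?_, ?_⟩ <;> linarith
  by_cases hx : x ∈ Ioo (0 : ℝ) 1 ×ˢ Ioo (0 : ℝ) 1
  · rw [onOpenSquare_apply _ hx, onOpenSquare_apply _ (hiff.mpr hx)]
  · rw [onOpenSquare, onOpenSquare, indicator_of_notMem hx,
      indicator_of_notMem (fun h => hx (hiff.mp h)), mul_zero]

/-! ### The space `𝓔_s` -/

/-- The Lerch function of parity `k`, as a function on the plane supported on the open square. -/
noncomputable def lerchFun (k : ℕ) (s : ℂ) : ℝ × ℝ → ℂ :=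
  onOpenSquare fun a c => lerchParity k s a c

lemma lerchTurn_lerchTurn_lerchFun (k : ℕ) (s : ℂ) :
    lerchTurn (lerchTurn (lerchFun k s)) = (-1 : ℂ) ^ k • lerchFun k s := by
  rw [lerchFun, smul_onOpenSquare, lerchTurn_onOpenSquare, lerchTurn_onOpenSquare]
  refine onOpenSquare_congr fun a _ c _ => ?_
  rw [← lerchParity_one_sub, ← mul_assoc, ← Complex.exp_add]
  congr 2
  push_cast
  ring

/-- The span of the even and the odd Lerch function at `s`, without their duals. -/
noncomputable def lerchPairSpan (s : ℂ) : Submodule ℂ (ℝ × ℝ → ℂ) :=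
  Submodule.span ℂ {lerchFun 0 s, lerchFun 1 s}

lemma lerchSpace_eq_sup (s : ℂ) :
    lerchSpace s = lerchPairSpan s ⊔ (lerchPairSpan (1 - s)).map lerchTurn := by
  have h1 : (onOpenSquare fun a c => lerchLPlus s a c) = lerchFun 0 s :=
    onOpenSquare_congr fun a ha c hc => lerchLPlus_eq s ha hc
  have h2 : (onOpenSquare fun a c => lerchLMinus s a c) = lerchFun 1 s :=
    onOpenSquare_congr fun a ha c hc => lerchLMinus_eq s ha hc
  have h3 : (onOpenSquare fun a c => Complex.exp (-2 * Real.pi * Complex.I * a * c) *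
      lerchLPlus (1 - s) (1 - c) a) = lerchTurn (lerchFun 0 (1 - s)) := by
    rw [lerchFun, lerchTurn_onOpenSquare]
    exact onOpenSquare_congr fun a ha c hc => by rw [lerchLPlus_eq _ (one_sub_mem_Ioo hc) ha]
  have h4 : (onOpenSquare fun a c => Complex.exp (-2 * Real.pi * Complex.I * a * c) *
      lerchLMinus (1 - s) (1 - c) a) = lerchTurn (lerchFun 1 (1 - s)) := by
    rw [lerchFun, lerchTurn_onOpenSquare]
    exact onOpenSquare_congr fun a ha c hc => by rw [lerchLMinus_eq _ (one_sub_mem_Ioo hc) ha]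
  rw [lerchSpace, h1, h2, h3, h4, lerchPairSpan, lerchPairSpan, Submodule.map_span, image_pair,
    ← Submodule.span_union, insert_union, singleton_union]

lemma lerchFun_mem_lerchPairSpan {k : ℕ} (hk : k ≤ 1) (s : ℂ) :
    lerchFun k s ∈ lerchPairSpan s := by
  interval_cases k <;> exact Submodule.subset_span (by simp)

lemma map_lerchTurn_lerchPairSpan_le {s : ℂ} (hs : 0 < s.re) :
    (lerchPairSpan (1 - s)).map lerchTurn ≤ lerchPairSpan s := by
  have key {k : ℕ} (hk : k ≤ 1) : lerchTurn (lerchFun k (1 - s)) ∈ lerchPairSpan s := by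
    obtain ⟨b, hb⟩ := exists_dual_lerchParity_eq hk hs
    have : lerchTurn (lerchFun k (1 - s)) = b • lerchFun k s := by
      rw [lerchFun, lerchFun, smul_onOpenSquare, lerchTurn_onOpenSquare]
      exact onOpenSquare_congr hb
    rw [this]
    exact Submodule.smul_mem _ _ (lerchFun_mem_lerchPairSpan hk s)
  rw [lerchPairSpan, Submodule.map_span, Submodule.span_le, image_pair]
  rintro _ (rfl | rfl)
  · exact key zero_le_one
  · exact key le_rfl

lemma lerchSpace_of_re_pos {s : ℂ} (hs : 0 < s.re) : lerchSpace s = lerchPairSpan s := by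
  rw [lerchSpace_eq_sup, sup_eq_left]
  exact map_lerchTurn_lerchPairSpan_le hs

lemma lerchSpace_of_re_lt_one {s : ℂ} (hs : s.re < 1) :
    lerchSpace s = (lerchPairSpan (1 - s)).map lerchTurn := by
  rw [lerchSpace_eq_sup, sup_eq_right]
  have h := map_lerchTurn_lerchPairSpan_le (s := 1 - s) (by simpa using hs)
  rw [sub_sub_cancel] at h
  have key {k : ℕ} (hk : k ≤ 1) : lerchFun k s ∈ (lerchPairSpan (1 - s)).map lerchTurn := by
    have h1 : lerchTurn (lerchFun k s) ∈ lerchPairSpan (1 - s) :=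
      h (Submodule.mem_map_of_mem (lerchFun_mem_lerchPairSpan hk s))
    refine ⟨(-1 : ℂ) ^ k • lerchTurn (lerchFun k s), Submodule.smul_mem _ _ h1, ?_⟩
    rw [map_smul, lerchTurn_lerchTurn_lerchFun, smul_smul, ← mul_pow]
    simp
  rw [lerchPairSpan, Submodule.span_le]
  rintro _ (rfl | rfl)
  · exact key zero_le_one
  · exact key le_rfl

/-! ### Membership in `L^p` -/

lemma aestronglyMeasurable_lerchFun {k : ℕ} (hk : k ≤ 1) (s : ℂ) :
    AEStronglyMeasurable (lerchFun k s) ((volume : Measure (ℝ × ℝ)).restrict lerchSquare) := by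
  refine AEStronglyMeasurable.indicator ?_ (measurableSet_Ioo.prod measurableSet_Ioo)
  have h : AEStronglyMeasurable (fun y : (ℝ × ℝ) × ℝ =>
      (y.2 : ℂ) ^ ((s + k) / 2 - 1) • lerchTheta k y.1.1 y.1.2 y.2)
      (((volume : Measure (ℝ × ℝ)).restrict lerchSquare).prod
        ((volume : Measure ℝ).restrict (Ioi 0))) := by
    rw [← Measure.restrict_univ (μ := (volume : Measure (ℝ × ℝ)).restrict lerchSquare),
      Measure.prod_restrict]
    refine ContinuousOn.aestronglyMeasurable (fun y hy => ?_)
      (MeasurableSet.univ.prod measurableSet_Ioi)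
    have hy' : 0 < y.2 := hy.2
    have hpow : ContinuousAt (fun y : (ℝ × ℝ) × ℝ => (y.2 : ℂ) ^ ((s + k) / 2 - 1)) y :=
      ContinuousAt.comp (f := fun y : (ℝ × ℝ) × ℝ => y.2)
        (Complex.continuousAt_ofReal_cpow_const _ _ (Or.inr hy'.ne')) continuousAt_snd
    have htheta : ContinuousAt (fun y : (ℝ × ℝ) × ℝ => lerchTheta k y.1.1 y.1.2 y.2) y :=
      ContinuousAt.comp (f := fun y : (ℝ × ℝ) × ℝ => (y.1.1, y.1.2, y.2))
        (g := fun x : ℝ × ℝ × ℝ => lerchTheta k x.1 x.2.1 x.2.2)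
        (continuousAt_lerchTheta hk _ hy') (by fun_prop)
    exact (hpow.smul htheta).continuousWithinAt
  exact h.integral_prod_right'.const_mul _

lemma norm_ofReal_cpow_neg {x : ℝ} (hx : 0 < x) (s : ℂ) : ‖(x : ℂ) ^ (-s)‖ = x ^ (-s.re) := by
  rw [Complex.norm_cpow_eq_rpow_re_of_pos hx, Complex.neg_re]

lemma memLp_lerchFun {k : ℕ} (hk : k ≤ 1) {p : ℝ} (hp : 1 ≤ p) {s : ℂ} (h1 : 1 - 1 / p < s.re)
    (h2 : s.re < 1 / p) : MemLp (lerchFun k s) (ENNReal.ofReal p)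
      ((volume : Measure (ℝ × ℝ)).restrict lerchSquare) := by
  have hp0 : 0 < p := by linarith
  have hp1 : 1 / p ≤ 1 := by rw [div_le_one hp0]; exact hp
  have hs : 0 < s.re := by linarith
  have hmul : 1 / p * p = 1 := by field_simp
  obtain ⟨C, hC, hbound⟩ := exists_norm_lerchParity_sub_le hk hs le_rfl (by linarith)
  have w1 : MemLp (fun x : ℝ => x ^ (s.re - 1)) (ENNReal.ofReal p)
      ((volume : Measure ℝ).restrict (Icc 0 1)) := memLp_rpow_Icc hp0 (by nlinarith)
  have w2 : MemLp (fun x : ℝ => x ^ (-s.re)) (ENNReal.ofReal p)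
      ((volume : Measure ℝ).restrict (Icc 0 1)) := memLp_rpow_Icc hp0 (by nlinarith)
  have w1' := w1.comp_measurePreserving measurePreserving_one_sub_Icc
  have w2' := w2.comp_measurePreserving measurePreserving_one_sub_Icc
  have hfst : MeasurePreserving Prod.fst ((volume : Measure (ℝ × ℝ)).restrict lerchSquare)
      ((volume : Measure ℝ).restrict (Icc 0 1)) := by
    rw [volume_restrict_lerchSquare]; exact measurePreserving_fst
  have hsnd : MeasurePreserving Prod.snd ((volume : Measure (ℝ × ℝ)).restrict lerchSquare)
      ((volume : Measure ℝ).restrict (Icc 0 1)) := by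
    rw [volume_restrict_lerchSquare]; exact measurePreserving_snd
  have : IsFiniteMeasure ((volume : Measure (ℝ × ℝ)).restrict lerchSquare) := by
    rw [volume_restrict_lerchSquare]; infer_instance
  have hmaj := (((((memLp_const (1 : ℝ)).add (w1.comp_measurePreserving hfst)).add
    (w1'.comp_measurePreserving hfst)).const_mul C).add (w2.comp_measurePreserving hsnd)).add
    (w2'.comp_measurePreserving hsnd)
  refine hmaj.mono' (aestronglyMeasurable_lerchFun hk s) ?_
  filter_upwards [ae_mem_openSquare] with x hx
  have hb := hbound x.1 hx.1 x.2 hx.2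
  have h4 : ‖lerchBoundary k s x.1 x.2‖ ≤ x.2 ^ (-s.re) + (1 - x.2) ^ (-s.re) := by
    refine (norm_add_le _ _).trans (le_of_eq ?_)
    rw [norm_mul, norm_mul, norm_exp_neg_two_pi_I_mul, norm_pow, norm_neg, norm_one, one_pow,
      one_mul, one_mul, norm_ofReal_cpow_neg hx.2.1, norm_ofReal_cpow_neg (one_sub_mem_Ioo hx.2).1]
  have h5 := norm_add_le (lerchParity k s x.1 x.2 - lerchBoundary k s x.1 x.2)
    (lerchBoundary k s x.1 x.2)
  rw [sub_add_cancel] at h5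
  rw [lerchFun, onOpenSquare_apply _ hx]
  simp only [Pi.add_apply, Function.comp_apply]
  linarith

lemma memLp_of_mem_lerchSpace {p : ℝ} (hp : 1 ≤ p) {s : ℂ} (h1 : 1 - 1 / p < s.re)
    (h2 : s.re < 1 / p) {F : ℝ × ℝ → ℂ} (hF : F ∈ lerchSpace s) : MemLp F (ENNReal.ofReal p)
      ((volume : Measure (ℝ × ℝ)).restrict lerchSquare) := by
  have hp1 : 1 / p ≤ 1 := by rw [div_le_one (by linarith)]; exact hp
  rw [lerchSpace_of_re_pos (by linarith)] at hF
  obtain ⟨α, β, rfl⟩ := Submodule.mem_span_pair.mp hF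
  exact ((memLp_lerchFun zero_le_one hp h1 h2).const_smul α).add
    ((memLp_lerchFun le_rfl hp h1 h2).const_smul β)

/-- If `α + β ≠ 0`, the singularity `(α + β) c^{-s}` on the side `c = 0` is visible on almost every
line `a = const`. -/
lemma not_memLp_of_add_ne_zero {p : ℝ} (hp : 1 ≤ p) {s : ℂ} (hs : 1 ≤ s.re * p) {α β : ℂ}
    (h : α + β ≠ 0) : ¬ MemLp (α • lerchFun 0 s + β • lerchFun 1 s) (ENNReal.ofReal p)
      ((volume : Measure (ℝ × ℝ)).restrict lerchSquare) := by
  intro hF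
  have hp0 : 0 < p := by linarith
  have hs0 : 0 < s.re := by
    by_contra hcon
    nlinarith
  have hint := hF.integrable_norm_rpow (by simpa using hp0) ENNReal.ofReal_ne_top
  rw [ENNReal.toReal_ofReal hp0.le, volume_restrict_lerchSquare] at hint
  have hslice := hint.prod_right_ae
  rw [Measure.restrict_congr_set (Ioo_ae_eq_Icc (a := (0 : ℝ)) (b := 1)).symm] at hslice
  have hne : (ae ((volume : Measure ℝ).restrict (Ioo 0 1))).NeBot :=
    ae_restrict_neBot.mpr (by simp)
  obtain ⟨a, hslice_a, ha⟩ := (hslice.and (ae_restrict_mem measurableSet_Ioo)).exists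
  set F := α • lerchFun 0 s + β • lerchFun 1 s with hFdef
  -- on a fixed line the size in `a` is irrelevant, so any exponent below `1` and `Re s` will do
  obtain ⟨C₀, -, hb0⟩ := exists_norm_lerchParity_sub_le zero_le_one hs0
    (min_le_left s.re 0) ((min_le_right s.re 0).trans_lt one_pos)
  obtain ⟨C₁, -, hb1⟩ := exists_norm_lerchParity_sub_le le_rfl hs0
    (min_le_left s.re 0) ((min_le_right s.re 0).trans_lt one_pos)
  set Q := 1 + a ^ (min s.re 0 - 1) + (1 - a) ^ (min s.re 0 - 1)
  set K := ‖α‖ * (C₀ * Q) + ‖β‖ * (C₁ * Q) + ‖α - β‖ * (1 / 2 : ℝ) ^ (-s.re)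
  have hlow : ∀ c ∈ Ioo (0 : ℝ) (1 / 2), ‖α + β‖ * c ^ (-s.re) ≤ ‖F (a, c)‖ + K := by
    intro c hc
    have hc1 : c ∈ Ioo (0 : ℝ) 1 := ⟨hc.1, by linarith [hc.2]⟩
    have e : (α + β) * (c : ℂ) ^ (-s) = F (a, c) -
        α * (lerchParity 0 s a c - lerchBoundary 0 s a c) -
        β * (lerchParity 1 s a c - lerchBoundary 1 s a c) -
        (α - β) * (Complex.exp (-2 * Real.pi * Complex.I * a) * ((1 - c : ℝ) : ℂ) ^ (-s)) := by
      simp only [hFdef, Pi.add_apply, Pi.smul_apply, smul_eq_mul, lerchFun]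
      rw [onOpenSquare_apply _ (show (a, c) ∈ _ from ⟨ha, hc1⟩),
        onOpenSquare_apply _ (show (a, c) ∈ _ from ⟨ha, hc1⟩), lerchBoundary, lerchBoundary]
      ring
    have n1 : ‖((1 - c : ℝ) : ℂ) ^ (-s)‖ ≤ (1 / 2 : ℝ) ^ (-s.re) := by
      rw [norm_ofReal_cpow_neg (one_sub_mem_Ioo hc1).1]
      exact Real.rpow_le_rpow_of_nonpos (by norm_num) (by linarith [hc.2]) (by linarith)
    rw [← norm_ofReal_cpow_neg hc.1, ← norm_mul, e]
    refine (norm_sub_le _ _).trans ?_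
    rw [norm_mul, norm_mul, norm_exp_neg_two_pi_I_mul, one_mul]
    have t1 := norm_sub_le (F (a, c) - α * (lerchParity 0 s a c - lerchBoundary 0 s a c))
      (β * (lerchParity 1 s a c - lerchBoundary 1 s a c))
    have t2 := norm_sub_le (F (a, c)) (α * (lerchParity 0 s a c - lerchBoundary 0 s a c))
    rw [norm_mul] at t1 t2
    have t3 := mul_le_mul_of_nonneg_left (hb0 a ha c hc1) (norm_nonneg α)
    have t4 := mul_le_mul_of_nonneg_left (hb1 a ha c hc1) (norm_nonneg β)
    have t5 := mul_le_mul_of_nonneg_left n1 (norm_nonneg (α - β))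
    linarith
  -- close to `c = 0` the bounded error is absorbed by half of the singular term
  have hev : ∀ᶠ c : ℝ in nhdsWithin 0 (Ioi 0), K ≤ ‖α + β‖ / 2 * c ^ (-s.re) :=
    ((tendsto_rpow_neg_nhdsGT_zero (by linarith : -s.re < 0)).const_mul_atTop
      (by positivity)).eventually_ge_atTop K
  obtain ⟨δ, hδ0, hδ⟩ := (mem_nhdsGT_iff_exists_Ioo_subset).mp hev
  have hδ0' : (0 : ℝ) < δ := hδ0
  set ε := min δ (1 / 2)
  have hε : 0 < ε := lt_min hδ0' (by norm_num)
  have hdiv : IntegrableOn (fun c : ℝ => c ^ (-s.re * p)) (Ioo 0 ε) := by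
    have hF' : IntegrableOn (fun c => ‖F (a, c)‖ ^ p) (Ioo 0 ε) :=
      IntegrableOn.mono_set hslice_a fun c hc =>
        ⟨hc.1, by linarith [hc.2, min_le_right δ (1 / 2)]⟩
    refine (hF'.const_mul ((2 / ‖α + β‖) ^ p)).mono'
      (measurable_id.pow_const _).aestronglyMeasurable ?_
    refine (ae_restrict_iff' measurableSet_Ioo).mpr (Filter.Eventually.of_forall fun c hc => ?_)
    have hc0 : 0 < c := hc.1
    have h1 := hlow c ⟨hc0, hc.2.trans_le (min_le_right _ _)⟩
    have h2 : K ≤ ‖α + β‖ / 2 * c ^ (-s.re) := hδ ⟨hc0, hc.2.trans_le (min_le_left _ _)⟩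
    have hpos : 0 < ‖α + β‖ := norm_pos_iff.mpr h
    have h3 : c ^ (-s.re) ≤ 2 / ‖α + β‖ * ‖F (a, c)‖ := by
      rw [div_mul_eq_mul_div, le_div_iff₀ hpos]
      linarith
    rw [Real.norm_of_nonneg (by positivity), Real.rpow_mul hc0.le,
      ← Real.mul_rpow (by positivity) (norm_nonneg _)]
    exact Real.rpow_le_rpow (by positivity) h3 hp0.le
  rw [intervalIntegral.integrableOn_Ioo_rpow_iff hε] at hdiv
  linarith

/-- If `α + β = 0` but `α - β ≠ 0`, the half turn moves the singularity on the side `c = 1` to the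
side `c = 0`. -/
lemma not_memLp_of_mem_lerchPairSpan {p : ℝ} (hp : 1 ≤ p) {s : ℂ} (hs : 1 ≤ s.re * p) {α β : ℂ}
    (h : α ≠ 0 ∨ β ≠ 0) : ¬ MemLp (α • lerchFun 0 s + β • lerchFun 1 s) (ENNReal.ofReal p)
      ((volume : Measure (ℝ × ℝ)).restrict lerchSquare) := by
  by_cases hab : α + β = 0
  · intro hF
    have h2 := memLp_lerchTurn (memLp_lerchTurn hF)
    simp only [map_add, map_smul, lerchTurn_lerchTurn_lerchFun, pow_zero, one_smul, pow_one,
      smul_smul] at h2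
    refine not_memLp_of_add_ne_zero hp hs (fun h3 => ?_) h2
    have hα : α = 0 := by linear_combination (hab + h3) / 2
    have hβ : β = 0 := by linear_combination (hab - h3) / 2
    tauto
  · exact not_memLp_of_add_ne_zero hp hs hab

lemma finrank_lerchPairSpan {s : ℂ} (hs : 1 / 2 ≤ s.re) :
    Module.finrank ℂ (lerchPairSpan s) = 2 := by
  have hli : LinearIndependent ℂ ![lerchFun 0 s, lerchFun 1 s] := by
    rw [LinearIndependent.pair_iff]
    intro α β h0
    by_contra hcon
    refine not_memLp_of_mem_lerchPairSpan (p := 2) (s := s) (α := α) (β := β) (by norm_num)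
      (by linarith) (by tauto) ?_
    rw [h0]
    exact MemLp.zero
  have := finrank_span_eq_card hli
  rwa [Matrix.range_cons, Matrix.range_cons, Matrix.range_empty, union_empty,
    singleton_union, Fintype.card_fin] at this

lemma finrank_lerchSpace (s : ℂ) : Module.finrank ℂ (lerchSpace s) = 2 := by
  rcases le_total (1 / 2) s.re with h | h
  · rw [lerchSpace_of_re_pos (by linarith), finrank_lerchPairSpan h]
  · rw [lerchSpace_of_re_lt_one (by linarith), ← finrank_lerchPairSpan (s := 1 - s)
      (by simp only [Complex.sub_re, Complex.one_re]; linarith)]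
    exact (LinearEquiv.finrank_eq
      (Submodule.equivMapOfInjective lerchTurn lerchTurn_injective _)).symm

lemma not_memLp_of_mem_lerchSpace {p : ℝ} (hp : 1 ≤ p) {s : ℂ}
    (hs : 1 ≤ s.re * p ∨ 1 ≤ (1 - s.re) * p) {F : ℝ × ℝ → ℂ} (hF : F ∈ lerchSpace s)
    (hF0 : F ≠ 0) : ¬ MemLp F (ENNReal.ofReal p)
      ((volume : Measure (ℝ × ℝ)).restrict lerchSquare) := by
  have hp0 : 0 < p := by linarith
  have key {z : ℂ} (hz : 1 ≤ z.re * p) {G : ℝ × ℝ → ℂ} (hG : G ∈ lerchPairSpan z)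
      (hG0 : G ≠ 0) : ¬ MemLp G (ENNReal.ofReal p)
        ((volume : Measure (ℝ × ℝ)).restrict lerchSquare) := by
    obtain ⟨α, β, rfl⟩ := Submodule.mem_span_pair.mp hG
    refine not_memLp_of_mem_lerchPairSpan hp hz ?_
    by_contra! hcon
    exact hG0 (by simp [hcon.1, hcon.2])
  rcases hs with hs | hs
  · rw [lerchSpace_of_re_pos (by by_contra hcon; nlinarith)] at hF
    exact key hs hF hF0
  · rw [lerchSpace_of_re_lt_one (by by_contra hcon; nlinarith)] at hF
    obtain ⟨G, hG, rfl⟩ := hF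
    exact fun hmem => key (z := 1 - s) (by simpa using hs) hG
      (fun hG0 => hF0 (by rw [hG0, map_zero])) (memLp_of_memLp_lerchTurn hmem)

theorem mainTheorem4 :
    -- `𝓔_s` is two-dimensional for every `s`
    (∀ s : ℂ, Module.finrank ℂ (lerchSpace s) = 2) ∧
    -- the range `1 ≤ p < 2`
    (∀ p : ℝ, 1 ≤ p → p < 2 → ∀ s : ℂ,
      ((∀ F ∈ lerchSpace s,
          MemLp F (ENNReal.ofReal p) ((volume : Measure (ℝ × ℝ)).restrict lerchSquare)) ↔
        (1 - 1 / p < s.re ∧ s.re < 1 / p)) ∧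
      (¬ (1 - 1 / p < s.re ∧ s.re < 1 / p) →
        ∀ F ∈ lerchSpace s, F ≠ 0 →
          ¬ MemLp F (ENNReal.ofReal p) ((volume : Measure (ℝ × ℝ)).restrict lerchSquare))) ∧
    -- the range `2 ≤ p ≤ ∞`
    (∀ p : ℝ≥0∞, 2 ≤ p → ∀ s : ℂ, ∀ F ∈ lerchSpace s, F ≠ 0 →
      ¬ MemLp F p ((volume : Measure (ℝ × ℝ)).restrict lerchSquare)) := by
  refine ⟨finrank_lerchSpace, fun p hp hp2 s => ?_, fun p hp s F hF hF0 hmem => ?_⟩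
  · have hp0 : 0 < p := by linarith
    have hout (hs : ¬ (1 - 1 / p < s.re ∧ s.re < 1 / p)) (F : ℝ × ℝ → ℂ)
        (hF : F ∈ lerchSpace s) (hF0 : F ≠ 0) :
        ¬ MemLp F (ENNReal.ofReal p) ((volume : Measure (ℝ × ℝ)).restrict lerchSquare) := by
      refine not_memLp_of_mem_lerchSpace hp ?_ hF hF0
      rw [← div_le_iff₀ hp0, ← div_le_iff₀ hp0]
      by_contra! hcon
      exact hs ⟨by linarith, hcon.1⟩
    refine ⟨⟨fun hall => ?_, fun hs F hF => memLp_of_mem_lerchSpace hp hs.1 hs.2 hF⟩, hout⟩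
    by_contra hs
    have hnontriv : Nontrivial (lerchSpace s) :=
      Module.nontrivial_of_finrank_pos (R := ℂ) (by rw [finrank_lerchSpace]; norm_num)
    obtain ⟨⟨F, hF⟩, hF0⟩ := exists_ne (0 : lerchSpace s)
    exact hout hs F hF (fun h => hF0 (Subtype.ext h)) (hall F hF)
  · have : IsFiniteMeasure ((volume : Measure (ℝ × ℝ)).restrict lerchSquare) := by
      rw [volume_restrict_lerchSquare]; infer_instance
    -- on a finite measure space membership in `L^p` with `p ≥ 2` implies membership in `L²`
    have h2 : ENNReal.ofReal 2 ≤ p := by simpa using hp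
    refine not_memLp_of_mem_lerchSpace (p := 2) (by norm_num) ?_ hF hF0 (hmem.mono_exponent h2)
    by_contra! hcon
    linarith [hcon.1, hcon.2]
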